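/- **Conventions.** A left brace is a set $B$ with an abelian group structure $(B,+)$ and a group structure $(B,\cdot)$ such that $a(b+c)+a=ab+ac$ for all $a,b,c$; its lambda map is $\lambda_a(b)=-a+ab$, and its socle is the ideal $\operatorname{soc}(B)=\{a\in B: ab=a+b\text{ for all }b\in B\}$. A homomorphism of left braces is a map preserving $+$ and $\cdot$. The solution of the Yang–Baxter equation associated to $B$ is $r_B(a,b)=(\lambda_a(b),\lambda_{\lambda_a(b)}^{-1}(a))$. For an involutive non-degenerate set-theoretic solution $(X,r)$, $r(x,y)=(\sigma_x(y),\gamma_y(x))$, the structure group $G(X,r)=\langle X\mid xy=\sigma_x(y)\gamma_y(x)\ (x,y\in X)\rangle$ carries its natural left brace structure, with $\lambda_x(y)=\sigma_x(y)$ for $x,y\in X$, and the permutation group $\mathcal G(X,r)=\langle\sigma_x: x\in X\rangle\le \mathrm{Sym}_X$ carries the unique left brace structure, with composition as multiplication, for which $G(X,r)\to\mathcal G(X,r)$, $x\mapsto\sigma_x$, is a homomorphism of left braces. **Setting.** Let $A$ be an additive abelian group of finite exponent $n>1$, let $t\in\operatorname{Aut}(A)$ be such that $t-\mathrm{id}\in\operatorname{Aut}(A)$,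 and let $T=\langle t\rangle\le\operatorname{Aut}(A)$. Let $(j_a)_{a\in A}$ be a family of elements of $A$ with $j_a=j_{-a}$ and $j_{t^z(a)}=t^z(j_a)-(t^z-\mathrm{id})(j_0)$ for all $a\in A$, $z\in\mathbb Z$. Let $A_1=A\rtimes T$ be the left brace with $$(a,u)+(c,v)=(a+c,uv),\qquad (a,u)(c,v)=(a+u(c),uv).$$ Let $H'$ be the additive group of finitely supported functions $A\to\mathbb Z/(n)$. Let $A_1$ act on $H'$ by $\alpha'(a,t^z)(f)=f\circ g_{(a,t^z)}$, where $$g_{(a,t^z)}(x)=t^{-z}\bigl(x-a-(t-\mathrm{id})^{-2}(t^{z+1}-t)(j_0)\bigr),$$ and let $b'\colon H'\times H'\to A_1$ be the bilinear form $$b'(f,h)=\Bigl(\sum_{x,y\in A}f(x)h(y)\,t(j_{x-y}-j_0),\ \mathrm{id}\Bigr).$$ Let $B'=H'\rtimes_\circ A_1$ be the asymmetric product, that is, the left brace on $H'\times A_1$ with $$(f,p)(h,q)=(f+\alpha'(p)(h),\,pq),\qquad (f,p)+(h,q)=(f+h,\ p+q+b'(f,h)).$$ For $a,c\in A$ put $x'_{(a,c)}=(e'_a,(c-t(t-\mathrm{id})^{-1}(j_0),t))\in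 B'$, where $e'_a(a)=1$ and $e'_a(x)=0$ for $x\ne a$. Let $X'=\{x'_{(a,c)}: a,c\in A\}$ and let $r'$ be the restriction to $X'\times X'$ of the solution $r_{B'}$; then $(X',r')$ is a solution. **Proposition.** Suppose that the order of $t$ is finite and coprime to $n$. Then $$B'/\operatorname{soc}(B')\cong\mathcal G(X',r')$$ as left braces, and $$\operatorname{soc}(B')=\{(f,(0,\mathrm{id})): f\in H',\ b'(f,h)=(0,\mathrm{id})\text{ for all }h\in H'\}.$$ Moreover, the left braces $B'$ and $\mathcal G(X',r')$ are isomorphic if and only if $b'$ is non-singular, i.e. the only $f\in H'$ with $b'(f,h)=(0,\mathrm{id})$ for all $h\in H'$ is $f=0$. -/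

import Mathlib

/-! ### Left braces -/

/-- A left brace: an abelian group `(B, +)` and a group `(B, *)` on the same set such that
`a * (b + c) + a = a * b + a * c`. -/
class LeftBrace (B : Type*) extends AddCommGroup B, Group B where
  brace_eq : ∀ a b c : B, a * (b + c) + a = a * b + a * c

namespace LeftBrace

variable {B : Type*} [LeftBrace B]

theorem mul_add' (a b c : B) : a * (b + c) = a * b + a * c - a := by
  rw [← brace_eq]; abel

theorem mul_zero' (a : B) : a * 0 = a := by
  have h := brace_eq a 0 0
  rw [add_zero] at h
  exact (add_left_cancel h).symm

theorem one_eq_zero : (1 : B) = 0 := by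
  have h := mul_zero' (1 : B)
  rw [one_mul] at h
  exact h.symm

theorem mul_neg' (a b : B) : a * (-b) = a + a - a * b := by
  have h := brace_eq a b (-b)
  rw [add_neg_cancel, mul_zero'] at h
  rw [h]; abel

/-- The lambda map `λ_a (b) = -a + a * b`, an automorphism of the additive group. -/
def lam (a : B) : B ≃+ B where
  toFun b := -a + a * b
  invFun b := -a⁻¹ + a⁻¹ * b
  left_inv b := by
    change -a⁻¹ + a⁻¹ * (-a + a * b) = b
    rw [mul_add', mul_neg', inv_mul_cancel, inv_mul_cancel_left, one_eq_zero]; abel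
  right_inv b := by
    change -a + a * (-a⁻¹ + a⁻¹ * b) = b
    rw [mul_add', mul_neg', mul_inv_cancel, mul_inv_cancel_left, one_eq_zero]; abel
  map_add' b c := by rw [mul_add']; abel

theorem lam_apply (a b : B) : lam a b = -a + a * b := rfl

theorem lam_symm_apply (a b : B) : (lam a).symm b = lam a⁻¹ b := rfl

theorem add_lam (a b : B) : a + lam a b = a * b := by rw [lam_apply]; abel

theorem lam_mul (a b c : B) : lam (a * b) c = lam a (lam b c) := by
  simp only [lam_apply]
  rw [mul_add', mul_neg', mul_assoc]; abel

theorem lam_one (c : B) : lam 1 c = c := by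
  rw [lam_apply, one_mul, one_eq_zero, neg_zero, zero_add]

theorem lam_inv_lam (a c : B) : lam a⁻¹ (lam a c) = c := by
  rw [← lam_mul, inv_mul_cancel, lam_one]

theorem lam_lam_inv (a c : B) : lam a (lam a⁻¹ c) = c := by
  rw [← lam_mul, mul_inv_cancel, lam_one]

/-- `a + b = a * λ_a⁻¹ (b)`. -/
theorem add_eq_mul_lam (a b : B) : a + b = a * lam a⁻¹ b := by
  rw [← add_lam, lam_lam_inv]

/-- `λ_a (b) (γ_b (a)) = a b`, where `γ_b (a) = λ_{λ_a (b)}⁻¹ (a)`. -/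
theorem gam_eq (a b : B) : (lam (lam a b)).symm a = (lam a b)⁻¹ * (a * b) := by
  rw [lam_symm_apply, ← add_lam a b, add_comm a, add_eq_mul_lam (lam a b) a, inv_mul_cancel_left]

/-- An ideal of a left brace: a normal subgroup of the multiplicative group that is invariant
under all the maps `λ_a`. -/
structure Ideal (B : Type*) [LeftBrace B] extends Subgroup B where
  normal : toSubgroup.Normal
  lam_mem : ∀ (a : B) {b : B}, b ∈ carrier → lam a b ∈ carrier

namespace Ideal

variable (I : Ideal B)

/-- The underlying additive subgroup of an ideal. -/
def toAddSubgroup : AddSubgroup B where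
  carrier := {a | a ∈ I.toSubgroup}
  zero_mem' := by
    have h := I.toSubgroup.one_mem
    rw [one_eq_zero] at h
    exact h
  add_mem' {a b} ha hb := by
    change a + b ∈ I.toSubgroup
    rw [add_eq_mul_lam]
    exact I.toSubgroup.mul_mem ha (I.lam_mem _ hb)
  neg_mem' {a} ha := by
    change -a ∈ I.toSubgroup
    have h : -a = lam a a⁻¹ := by rw [lam_apply, mul_inv_cancel, one_eq_zero, add_zero]
    rw [h]
    exact I.lam_mem _ (I.toSubgroup.inv_mem ha)

theorem mem_toAddSubgroup {a : B} : a ∈ I.toAddSubgroup ↔ a ∈ I.toSubgroup := Iff.rfl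

/-- Additive and multiplicative cosets of an ideal agree. -/
theorem neg_add_mem_iff (a b : B) : -a + b ∈ I.toAddSubgroup ↔ a⁻¹ * b ∈ I.toSubgroup := by
  have h : a⁻¹ * b = lam a⁻¹ (-a + b) := by
    rw [lam_apply, mul_add', mul_neg', inv_mul_cancel, one_eq_zero]; abel
  rw [mem_toAddSubgroup, h]
  refine ⟨fun k => I.lam_mem _ k, fun k => ?_⟩
  have := I.lam_mem a k
  rw [lam_lam_inv] at this
  exact this

/-- The quotient of a left brace by an ideal, as the set of cosets. -/
def Quotient : Type _ := B ⧸ I.toAddSubgroup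

instance : AddCommGroup I.Quotient :=
  inferInstanceAs (AddCommGroup (B ⧸ I.toAddSubgroup))

/-- The class of an element in the quotient left brace. -/
def toQuot (a : B) : I.Quotient := QuotientAddGroup.mk a

theorem toQuot_surjective (x : I.Quotient) : ∃ a, I.toQuot a = x := QuotientAddGroup.mk_surjective x

theorem toQuot_eq_iff {a b : B} : I.toQuot a = I.toQuot b ↔ a⁻¹ * b ∈ I.toSubgroup := by
  rw [← neg_add_mem_iff]
  exact QuotientAddGroup.eq

theorem toQuot_add (a b : B) : I.toQuot (a + b) = I.toQuot a + I.toQuot b := rfl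

/-- Multiplication of classes. -/
instance : Mul I.Quotient :=
  ⟨_root_.Quotient.map₂ (fun a b => a * b) (by
    intro a a' ha b b' hb
    refine _root_.Quotient.exact (?_ : I.toQuot (a * b) = I.toQuot (a' * b'))
    have ha' : I.toQuot a = I.toQuot a' := _root_.Quotient.sound ha
    have hb' : I.toQuot b = I.toQuot b' := _root_.Quotient.sound hb
    rw [toQuot_eq_iff] at ha' hb' ⊢
    have e : (a * b)⁻¹ * (a' * b') = (b⁻¹ * (a⁻¹ * a') * b⁻¹⁻¹) * (b⁻¹ * b') := by group
    rw [e]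
    exact I.toSubgroup.mul_mem (I.normal.conj_mem _ ha' _) hb')⟩

theorem toQuot_mul (a b : B) : I.toQuot (a * b) = I.toQuot a * I.toQuot b := rfl

/-- Inverses of classes. -/
instance : Inv I.Quotient :=
  ⟨_root_.Quotient.map (fun a => a⁻¹) (by
    intro a a' ha
    refine _root_.Quotient.exact (?_ : I.toQuot a⁻¹ = I.toQuot a'⁻¹)
    have ha' : I.toQuot a = I.toQuot a' := _root_.Quotient.sound ha
    rw [toQuot_eq_iff] at ha' ⊢
    have e : a⁻¹⁻¹ * a'⁻¹ = (a * (a⁻¹ * a') * a⁻¹)⁻¹ := by group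
    rw [e]
    exact I.toSubgroup.inv_mem (I.normal.conj_mem _ ha' _))⟩

theorem toQuot_inv (a : B) : I.toQuot a⁻¹ = (I.toQuot a)⁻¹ := rfl

instance : One I.Quotient := ⟨I.toQuot 1⟩

theorem toQuot_one : I.toQuot 1 = 1 := rfl

instance : Group I.Quotient :=
  Group.ofLeftAxioms
    (by
      intro x y z
      obtain ⟨a, rfl⟩ := I.toQuot_surjective x
      obtain ⟨b, rfl⟩ := I.toQuot_surjective y
      obtain ⟨c, rfl⟩ := I.toQuot_surjective z
      rw [← toQuot_mul, ← toQuot_mul, ← toQuot_mul, ← toQuot_mul, mul_assoc])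
    (by
      intro x
      obtain ⟨a, rfl⟩ := I.toQuot_surjective x
      rw [← toQuot_one, ← toQuot_mul, one_mul])
    (by
      intro x
      obtain ⟨a, rfl⟩ := I.toQuot_surjective x
      rw [← toQuot_inv, ← toQuot_mul, inv_mul_cancel, toQuot_one])

/-- The quotient left brace `B / I`. -/
instance : LeftBrace I.Quotient where
  brace_eq x y z := by
    obtain ⟨a, rfl⟩ := I.toQuot_surjective x
    obtain ⟨b, rfl⟩ := I.toQuot_surjective y
    obtain ⟨c, rfl⟩ := I.toQuot_surjective z
    rw [← toQuot_add, ← toQuot_mul, ← toQuot_add, brace_eq, ← toQuot_mul, ← toQuot_mul, toQuot_add]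

end Ideal

theorem mul_eq_add_iff (a : B) : (∀ b, a * b = a + b) ↔ ∀ b, lam a b = b := by
  refine forall_congr' fun b => ?_
  rw [← add_lam]
  exact add_right_inj a

/-- The socle `{a | a * b = a + b for all b}`, which is an ideal. -/
def socle (B : Type*) [LeftBrace B] : Ideal B where
  carrier := {a | ∀ b : B, a * b = a + b}
  one_mem' b := by rw [one_mul, one_eq_zero, zero_add]
  mul_mem' {a c} ha hc := by
    refine (mul_eq_add_iff (a * c)).2 fun b => ?_
    rw [lam_mul, (mul_eq_add_iff c).1 hc, (mul_eq_add_iff a).1 ha]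
  inv_mem' {a} ha := by
    refine (mul_eq_add_iff a⁻¹).2 fun b => ?_
    have h := lam_inv_lam a b
    rwa [(mul_eq_add_iff a).1 ha] at h
  normal := ⟨fun a ha g => by
    refine (mul_eq_add_iff (g * a * g⁻¹)).2 fun b => ?_
    rw [lam_mul, lam_mul, (mul_eq_add_iff a).1 ha, lam_lam_inv]⟩
  lam_mem g {a} ha := by
    have hconj : lam g a = g * a * g⁻¹ := by
      have hg : ∀ x, (g * a * g⁻¹) * x = g * a * g⁻¹ + x := by
        refine (mul_eq_add_iff (g * a * g⁻¹)).2 fun b => ?_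
        rw [lam_mul, lam_mul, (mul_eq_add_iff a).1 ha, lam_lam_inv]
      have h := hg g
      rw [inv_mul_cancel_right] at h
      have h' : lam g a = -g + (g * a * g⁻¹ + g) := congrArg (fun x => -g + x) h
      rw [h', add_comm (g * a * g⁻¹), neg_add_cancel_left]
    rw [hconj]
    refine (mul_eq_add_iff (g * a * g⁻¹)).2 fun b => ?_
    rw [lam_mul, lam_mul, (mul_eq_add_iff a).1 ha, lam_lam_inv]

end LeftBrace

/-! ### Solutions of the Yang--Baxter equation -/

/-- `r × id` on `X³`. -/
def ybe12 {X : Type*} (r : X × X → X × X) (p : X × X × X) : X × X × X :=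
  ((r (p.1, p.2.1)).1, (r (p.1, p.2.1)).2, p.2.2)

/-- `id × r` on `X³`. -/
def ybe23 {X : Type*} (r : X × X → X × X) (p : X × X × X) : X × X × X :=
  (p.1, r p.2)

/-- An involutive, non-degenerate set-theoretic solution `r (x, y) = (σ_x (y), γ_y (x))` of the
Yang--Baxter equation on `X`. -/
structure YBESolution (X : Type*) where
  r : X × X → X × X
  involutive : ∀ p, r (r p) = p
  bijective_left : ∀ x, Function.Bijective fun y => (r (x, y)).1
  bijective_right : ∀ y, Function.Bijective fun x => (r (x, y)).2
  braid : ∀ p, ybe12 r (ybe23 r (ybe12 r p)) = ybe23 r (ybe12 r (ybe23 r p))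

namespace YBESolution

variable {X : Type*} (S : YBESolution X)

theorem perm_apply_inv {Y : Type*} (f : Equiv.Perm Y) (y : Y) : f (f⁻¹ y) = y :=
  Equiv.apply_symm_apply f y

theorem perm_inv_apply {Y : Type*} (f : Equiv.Perm Y) (y : Y) : f⁻¹ (f y) = y :=
  Equiv.symm_apply_apply f y

/-- The permutation `σ_x` of `X`. -/
noncomputable def sigma (x : X) : Equiv.Perm X := Equiv.ofBijective _ (S.bijective_left x)

/-- The map `γ_y`. -/
def gamma (y x : X) : X := (S.r (x, y)).2

theorem r_eq (x y : X) : S.r (x, y) = (S.sigma x y, S.gamma y x) := rfl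

theorem sigma_sigma_gamma (x y : X) : S.sigma (S.sigma x y) (S.gamma y x) = x := by
  exact congrArg Prod.fst (S.involutive (x, y))

theorem gamma_gamma_sigma (x y : X) : S.gamma (S.gamma y x) (S.sigma x y) = y := by
  exact congrArg Prod.snd (S.involutive (x, y))

theorem sigma_mul_sigma (x y : X) :
    S.sigma x * S.sigma y = S.sigma (S.sigma x y) * S.sigma (S.gamma y x) := by
  ext z
  have h := congrArg (fun q => q.1) (S.braid (x, y, z))
  exact h.symm

/-- The map `x ↦ σ_x⁻¹ (x)` is bijective: for every `b` there is exactly one `a` with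
`σ_a (b) = a`. -/
theorem existsUnique_sigma (b : X) : ∃! a, S.sigma a b = a := by
  obtain ⟨a, ha⟩ := (S.bijective_right b).2 b
  have ha' : S.gamma b a = b := ha
  refine ⟨a, ?_, fun c hc => ?_⟩
  · apply (S.bijective_right b).1
    change S.gamma b (S.sigma a b) = S.gamma b a
    have h := S.gamma_gamma_sigma a b
    rw [ha'] at h
    rw [h, ha']
  · apply (S.bijective_right b).1
    change S.gamma b c = S.gamma b a
    have hc' : S.sigma c b = c := hc
    have h := S.sigma_sigma_gamma c b
    rw [hc'] at h
    rw [ha']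
    exact (S.sigma c).injective (h.trans hc'.symm)

/-- A group `G` generated by elements `ι x`, for `x ∈ X`, that satisfy the relations
`ι x * ι y = ι (σ_x (y)) * ι (γ_y (x))`, and that acts on `X` with `ι x` acting as `σ_x`. The
structure group and the permutation group of a solution are of this kind. -/
structure GeneratedGroup (G : Type*) [Group G] where
  ρ : G →* Equiv.Perm X
  ι : X → G
  ρ_ι : ∀ x, ρ (ι x) = S.sigma x
  rel : ∀ x y, ι x * ι y = ι (S.sigma x y) * ι (S.gamma y x)
  generates : Subgroup.closure (Set.range ι) = ⊤

namespace GeneratedGroup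

variable {S} {G : Type*} [Group G] (E : S.GeneratedGroup G)

/-- The map `g ↦ g * ι (g⁻¹ x)`; it is going to be `g ↦ g + ι x`. -/
def shiftFun (x : X) (g : G) : G := g * E.ι (E.ρ g⁻¹ x)

theorem shiftFun_bijective (x : X) : Function.Bijective (E.shiftFun x) := by
  have key : ∀ g : G, S.sigma (E.ρ g⁻¹ x) (E.ρ (E.shiftFun x g)⁻¹ x) = E.ρ g⁻¹ x := by
    intro g
    rw [shiftFun, mul_inv_rev, map_mul, map_inv E.ρ (E.ι _), E.ρ_ι, Equiv.Perm.mul_apply,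
      perm_apply_inv]
  constructor
  · intro g h hgh
    have hg := key g
    have hh := key h
    rw [← hgh] at hh
    have e := (S.existsUnique_sigma (E.ρ (E.shiftFun x g)⁻¹ x)).unique hg hh
    have hgh' := hgh
    rw [shiftFun, shiftFun, e] at hgh'
    exact mul_right_cancel hgh'
  · intro h
    obtain ⟨a, ha, -⟩ := S.existsUnique_sigma (E.ρ h⁻¹ x)
    have e : E.ρ (h * (E.ι a)⁻¹)⁻¹ x = a := by
      rw [mul_inv_rev, inv_inv, map_mul, E.ρ_ι, Equiv.Perm.mul_apply]
      exact ha
    exact ⟨h * (E.ι a)⁻¹, by rw [shiftFun, e, inv_mul_cancel_right]⟩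

/-- `shiftFun` as a permutation of `G`. -/
noncomputable def shift (x : X) : Equiv.Perm G := Equiv.ofBijective _ (E.shiftFun_bijective x)

theorem shift_apply (x : X) (g : G) : E.shift x g = g * E.ι (E.ρ g⁻¹ x) := rfl

theorem shift_comm (x y : X) : E.shift x * E.shift y = E.shift y * E.shift x := by
  have key : ∀ a b : X, E.ι a * E.ι ((S.sigma a)⁻¹ b) = E.ι b * E.ι ((S.sigma b)⁻¹ a) := by
    intro a b
    rw [E.rel, perm_apply_inv]
    have h := S.sigma_sigma_gamma a ((S.sigma a)⁻¹ b)
    rw [perm_apply_inv] at h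
    rw [Equiv.Perm.eq_inv_iff_eq.2 h]
  ext g
  simp only [Equiv.Perm.mul_apply, shift_apply, mul_inv_rev, map_mul, map_inv E.ρ (E.ι _), E.ρ_ι]
  rw [mul_assoc, mul_assoc, key]

/-- The group of permutations of `G` generated by the shifts. It is abelian and acts simply
transitively on `G`. -/
def translations : Subgroup (Equiv.Perm G) := Subgroup.closure (Set.range E.shift)

theorem shift_mem (x : X) : E.shift x ∈ E.translations := Subgroup.subset_closure ⟨x, rfl⟩

theorem translations_comm (m n : E.translations) : m * n = n * m := by
  have := Subgroup.isMulCommutative_closure (k := Set.range E.shift) (by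
    rintro _ ⟨x, rfl⟩ _ ⟨y, rfl⟩
    exact E.shift_comm x y)
  exact this.is_comm.comm m n

theorem translations_bijective : Function.Bijective fun n : E.translations => n.1 1 := by
  have surj : ∀ g : G, ∃ n : E.translations, n.1 1 = g := by
    intro g
    have hg : g ∈ Subgroup.closure (Set.range E.ι) := by rw [E.generates]; trivial
    induction hg using Subgroup.closure_induction_right with
    | one => exact ⟨1, rfl⟩
    | mul_right g _ y hy ih =>
      obtain ⟨n, hn⟩ := ih
      obtain ⟨y, rfl⟩ := hy
      refine ⟨⟨E.shift (E.ρ g y), E.shift_mem _⟩ * n, ?_⟩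
      change E.shift (E.ρ g y) (n.1 1) = _
      rw [hn, shift_apply, map_inv, perm_inv_apply]
    | mul_inv_cancel g _ y hy ih =>
      obtain ⟨n, hn⟩ := ih
      obtain ⟨y, rfl⟩ := hy
      refine ⟨⟨E.shift (E.ρ (g * (E.ι y)⁻¹) y), E.shift_mem _⟩⁻¹ * n, ?_⟩
      change (E.shift (E.ρ (g * (E.ι y)⁻¹) y))⁻¹ (n.1 1) = _
      rw [hn, Equiv.Perm.inv_eq_iff_eq, shift_apply, map_inv E.ρ (_ * _),
        perm_inv_apply, inv_mul_cancel_right]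
  refine ⟨fun m n hmn => ?_, surj⟩
  ext g
  obtain ⟨k, rfl⟩ := surj g
  have hm := congrArg (fun z : E.translations => z.1 1) (E.translations_comm m k)
  have hn := congrArg (fun z : E.translations => z.1 1) (E.translations_comm n k)
  have hmn' : m.1 1 = n.1 1 := hmn
  change m.1 (k.1 1) = k.1 (m.1 1) at hm
  change n.1 (k.1 1) = k.1 (n.1 1) at hn
  rw [hm, hn, hmn']

/-- The bijection `n ↦ n (1)` from the group of translations to `G`. -/
noncomputable def orbitEquiv : E.translations ≃ G := Equiv.ofBijective _ E.translations_bijective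

theorem orbitEquiv_apply (n : E.translations) : E.orbitEquiv n = n.1 1 := rfl

/-- The abelian group structure on `G` transported from the group of translations. -/
@[reducible] noncomputable def addCommGroup : AddCommGroup G :=
  letI : CommGroup E.translations :=
    { (inferInstance : Group E.translations) with mul_comm := E.translations_comm }
  Equiv.addCommGroup (E.orbitEquiv.symm.trans Additive.ofMul)

theorem add_eq (m n : E.translations) :
    (letI := E.addCommGroup; E.orbitEquiv m + E.orbitEquiv n) = E.orbitEquiv (m * n) := by
  change E.orbitEquiv (E.orbitEquiv.symm (E.orbitEquiv m) * E.orbitEquiv.symm (E.orbitEquiv n)) = _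
  rw [Equiv.symm_apply_apply, Equiv.symm_apply_apply]

/-- Left multiplications normalize the group of translations. -/
theorem exists_conj (a : G) (n : E.translations) :
    ∃ n' : E.translations, ∀ g, a * n.1 g = n'.1 (a * g) := by
  obtain ⟨n, hn⟩ := n
  change ∃ n' : E.translations, ∀ g, a * n g = n'.1 (a * g)
  induction hn using Subgroup.closure_induction with
  | mem x hx =>
    obtain ⟨x, rfl⟩ := hx
    refine ⟨⟨E.shift (E.ρ a x), E.shift_mem _⟩, fun g => ?_⟩
    change _ = E.shift (E.ρ a x) (a * g)
    rw [shift_apply, shift_apply, mul_inv_rev, map_mul, map_inv E.ρ a, Equiv.Perm.mul_apply,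
      perm_inv_apply, mul_assoc]
  | one => exact ⟨1, fun g => rfl⟩
  | mul m n _ _ hm hn =>
    obtain ⟨m', hm⟩ := hm
    obtain ⟨n', hn⟩ := hn
    refine ⟨m' * n', fun g => ?_⟩
    change a * m (n g) = m'.1 (n'.1 (a * g))
    rw [hm, hn]
  | inv m _ hm =>
    obtain ⟨m', hm⟩ := hm
    refine ⟨m'⁻¹, fun g => ?_⟩
    change a * m⁻¹ g = m'.1⁻¹ (a * g)
    rw [Equiv.Perm.eq_inv_iff_eq, ← hm, perm_apply_inv]

/-- The left brace structure on `G` whose multiplication is that of `G` and whose lambda map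
satisfies `λ_g (ι x) = ι (g x)`. -/
@[reducible] noncomputable def leftBrace : LeftBrace G :=
  { E.addCommGroup, (inferInstance : Group G) with
    brace_eq := by
      intro a b c
      let _ := E.addCommGroup
      change a * (b + c) + a = a * b + a * c
      obtain ⟨n, rfl⟩ := E.orbitEquiv.surjective b
      obtain ⟨m, rfl⟩ := E.orbitEquiv.surjective c
      obtain ⟨n', hn⟩ := E.exists_conj a n
      obtain ⟨m', hm⟩ := E.exists_conj a m
      obtain ⟨k, hk⟩ := E.orbitEquiv.surjective a
      have hk1 : a * 1 = k.1 1 := by rw [mul_one, ← hk]; rfl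
      have e1 : a * E.orbitEquiv n = E.orbitEquiv (n' * k) := by
        rw [orbitEquiv_apply, hn, hk1]; rfl
      have e2 : a * E.orbitEquiv m = E.orbitEquiv (m' * k) := by
        rw [orbitEquiv_apply, hm, hk1]; rfl
      have e3 : a * E.orbitEquiv (n * m) = E.orbitEquiv (n' * (m' * k)) := by
        rw [orbitEquiv_apply]
        change a * n.1 (m.1 1) = _
        rw [hn, hm, hk1]; rfl
      rw [E.add_eq n m, e1, e2, e3]
      have e4 : E.orbitEquiv (n' * (m' * k)) + a = E.orbitEquiv (n' * (m' * k) * k) := by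
        rw [← hk]
        exact E.add_eq _ _
      rw [e4, E.add_eq, mul_assoc, mul_assoc, mul_assoc, E.translations_comm k (m' * k),
        mul_assoc] }

theorem add_ι (g : G) (x : X) :
    (letI := E.leftBrace; g + E.ι x) = E.shift x g := by
  obtain ⟨n, rfl⟩ := E.orbitEquiv.surjective g
  have h : E.ι x = E.orbitEquiv ⟨E.shift x, E.shift_mem x⟩ := by
    rw [orbitEquiv_apply]
    change _ = E.shift x 1
    rw [shift_apply, inv_one, map_one, one_mul, Equiv.Perm.one_apply]
  rw [h]
  refine (E.add_eq n _).trans ?_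
  rw [E.translations_comm]
  rfl

theorem lam_ι (g : G) (x : X) :
    (letI := E.leftBrace; LeftBrace.lam g (E.ι x)) = E.ι (E.ρ g x) := by
  let _ := E.leftBrace
  have h := E.add_ι g (E.ρ g x)
  rw [shift_apply, map_inv, perm_inv_apply] at h
  refine add_left_cancel (a := g) ?_
  rw [h]
  exact LeftBrace.add_lam g (E.ι x)

/-- An equivariant homomorphism between two such groups is additive. -/
theorem map_add {G' : Type*} [Group G'] (E' : S.GeneratedGroup G') (φ : G →* G')
    (hι : ∀ x, φ (E.ι x) = E'.ι x) (g h : G) :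
    φ (letI := E.leftBrace; g + h) = (letI := E'.leftBrace; φ g + φ h) := by
  have hρ : ∀ g, E'.ρ (φ g) = E.ρ g := by
    intro g
    have hg : g ∈ Subgroup.closure (Set.range E.ι) := by rw [E.generates]; trivial
    induction hg using Subgroup.closure_induction with
    | mem x hx =>
      obtain ⟨x, rfl⟩ := hx
      rw [hι, E.ρ_ι, E'.ρ_ι]
    | one => simp
    | mul a b _ _ ha hb => rw [map_mul, map_mul, map_mul, ha, hb]
    | inv a _ ha => rw [map_inv, map_inv, map_inv, ha]
  have hs : ∀ x g, φ (E.shift x g) = E'.shift x (φ g) := by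
    intro x g
    rw [shift_apply, shift_apply, map_mul, hι, ← map_inv, hρ]
  have hn : ∀ n : E.translations, ∃ n' : E'.translations, ∀ g, φ (n.1 g) = n'.1 (φ g) := by
    rintro ⟨n, hn⟩
    change ∃ n' : E'.translations, ∀ g, φ (n g) = n'.1 (φ g)
    induction hn using Subgroup.closure_induction with
    | mem x hx =>
      obtain ⟨x, rfl⟩ := hx
      exact ⟨⟨E'.shift x, E'.shift_mem x⟩, hs x⟩
    | one => exact ⟨1, fun g => rfl⟩
    | mul m n _ _ hm hn =>
      obtain ⟨m', hm⟩ := hm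
      obtain ⟨n', hn⟩ := hn
      refine ⟨m' * n', fun g => ?_⟩
      change φ (m (n g)) = m'.1 (n'.1 (φ g))
      rw [hm, hn]
    | inv m _ hm =>
      obtain ⟨m', hm⟩ := hm
      refine ⟨m'⁻¹, fun g => ?_⟩
      change φ (m⁻¹ g) = m'.1⁻¹ (φ g)
      rw [Equiv.Perm.eq_inv_iff_eq, ← hm, perm_apply_inv]
  obtain ⟨m, rfl⟩ := E.orbitEquiv.surjective g
  obtain ⟨n, rfl⟩ := E.orbitEquiv.surjective h
  obtain ⟨m', hm⟩ := hn m
  obtain ⟨n', hn⟩ := hn n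
  have em : φ (E.orbitEquiv m) = E'.orbitEquiv m' := by
    rw [orbitEquiv_apply, hm, map_one]; rfl
  have en : φ (E.orbitEquiv n) = E'.orbitEquiv n' := by
    rw [orbitEquiv_apply, hn, map_one]; rfl
  rw [em, en]
  refine (congrArg φ (E.add_eq m n)).trans (Eq.trans ?_ (E'.add_eq m' n').symm)
  rw [orbitEquiv_apply]
  change φ (m.1 (n.1 1)) = m'.1 (n'.1 1)
  rw [hm, hn, map_one]

end GeneratedGroup

/-- The relations `x y = σ_x (y) γ_y (x)` of the structure group. -/
def structureRels : Set (FreeGroup X) :=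
  {w | ∃ x y, w = FreeGroup.of x * FreeGroup.of y *
    (FreeGroup.of (S.sigma x y) * FreeGroup.of (S.gamma y x))⁻¹}

/-- The structure group `G(X, r)`. -/
def StructureGroup : Type _ := PresentedGroup S.structureRels

instance : Group S.StructureGroup := inferInstanceAs (Group (PresentedGroup S.structureRels))

/-- The permutation group `𝒢(X, r)`, the subgroup of `Sym X` generated by the `σ_x`. -/
def PermGroup : Type _ := Subgroup.closure (Set.range S.sigma)

noncomputable instance permGroupGroup : Group S.PermGroup :=
  inferInstanceAs (Group (Subgroup.closure (Set.range S.sigma)))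

/-- The canonical generators of the structure group. -/
def StructureGroup.of (x : X) : S.StructureGroup := PresentedGroup.of x

/-- The element `σ_x` of the permutation group. -/
noncomputable def PermGroup.of (x : X) : S.PermGroup :=
  ⟨S.sigma x, Subgroup.subset_closure ⟨x, rfl⟩⟩

/-- The canonical homomorphism `φ : G(X, r) → 𝒢(X, r)`, `x ↦ σ_x`. -/
noncomputable def toPermGroup : S.StructureGroup →* S.PermGroup :=
  PresentedGroup.toGroup (f := PermGroup.of S) (by
    rintro w ⟨x, y, rfl⟩
    simp only [map_mul, map_inv, FreeGroup.lift_apply_of]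
    rw [mul_inv_eq_one]
    exact Subtype.ext (S.sigma_mul_sigma x y))

theorem toPermGroup_of (x : X) : S.toPermGroup (StructureGroup.of S x) = PermGroup.of S x :=
  PresentedGroup.toGroup.of _

/-- The permutation group with its action on `X`. -/
noncomputable def permGroupGenerated : S.GeneratedGroup S.PermGroup where
  ρ := (Subgroup.closure (Set.range S.sigma)).subtype
  ι := PermGroup.of S
  ρ_ι _ := rfl
  rel x y := Subtype.ext (S.sigma_mul_sigma x y)
  generates := by
    have h := Subgroup.closure_closure_coe_preimage (k := Set.range S.sigma)
    have e : Set.range (PermGroup.of S) =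
        ((↑) : Subgroup.closure (Set.range S.sigma) → Equiv.Perm X) ⁻¹' Set.range S.sigma := by
      ext g
      constructor
      · rintro ⟨x, rfl⟩
        exact ⟨x, rfl⟩
      · rintro ⟨x, hx⟩
        exact ⟨x, Subtype.ext hx⟩
    exact (congrArg Subgroup.closure e).trans h

/-- The structure group with its action on `X` through `φ`. -/
noncomputable def structureGroupGenerated : S.GeneratedGroup S.StructureGroup where
  ρ := (S.permGroupGenerated.ρ).comp S.toPermGroup
  ι := StructureGroup.of S
  ρ_ι x := by
    rw [MonoidHom.comp_apply, toPermGroup_of]; rfl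
  rel x y := by
    rw [← mul_inv_eq_one]
    exact PresentedGroup.one_of_mem (rels := S.structureRels) ⟨x, y, rfl⟩
  generates := PresentedGroup.closure_range_of _

/-- The natural left brace structure on the structure group, with `λ_x (y) = σ_x (y)` for
`x, y ∈ X`. -/
noncomputable instance : LeftBrace S.StructureGroup := S.structureGroupGenerated.leftBrace

/-- The natural left brace structure on the permutation group: the only one for which
`φ : G(X, r) → 𝒢(X, r)` is a homomorphism of left braces. -/
noncomputable instance : LeftBrace S.PermGroup := S.permGroupGenerated.leftBrace

theorem StructureGroup.lam_of (x y : X) :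
    LeftBrace.lam (StructureGroup.of S x) (StructureGroup.of S y) =
      StructureGroup.of S (S.sigma x y) := by
  have h := S.structureGroupGenerated.lam_ι (StructureGroup.of S x) y
  rwa [show S.structureGroupGenerated.ρ (StructureGroup.of S x) = S.sigma x from
    S.structureGroupGenerated.ρ_ι x] at h

theorem toPermGroup_mul (g h : S.StructureGroup) :
    S.toPermGroup (g * h) = S.toPermGroup g * S.toPermGroup h := _root_.map_mul _ g h

theorem toPermGroup_add (g h : S.StructureGroup) :
    S.toPermGroup (g + h) = S.toPermGroup g + S.toPermGroup h :=
  S.structureGroupGenerated.map_add S.permGroupGenerated S.toPermGroup S.toPermGroup_of g h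

/-- The restriction of a solution to a subset that is stable under all `σ_x`, `γ_y` and their
inverses. -/
def restrict (Y : Set X) (hσ : ∀ x y, (S.r (x, y)).1 ∈ Y ↔ y ∈ Y)
    (hγ : ∀ x y, (S.r (x, y)).2 ∈ Y ↔ x ∈ Y) : YBESolution Y where
  r p := (⟨(S.r (p.1, p.2)).1, (hσ _ _).2 p.2.2⟩, ⟨(S.r (p.1, p.2)).2, (hγ _ _).2 p.1.2⟩)
  involutive p := by
    have h := S.involutive (p.1.1, p.2.1)
    exact Prod.ext (Subtype.ext (congrArg Prod.fst h)) (Subtype.ext (congrArg Prod.snd h))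
  bijective_left x := by
    constructor
    · intro y z h
      exact Subtype.ext ((S.bijective_left x.1).1 (congrArg Subtype.val h))
    · intro y
      obtain ⟨z, hz⟩ := (S.bijective_left x.1).2 y.1
      have hz' : (S.r (x.1, z)).1 = y.1 := hz
      exact ⟨⟨z, (hσ x.1 z).1 (hz' ▸ y.2)⟩, Subtype.ext hz⟩
  bijective_right y := by
    constructor
    · intro x z h
      exact Subtype.ext ((S.bijective_right y.1).1 (congrArg Subtype.val h))
    · intro x
      obtain ⟨z, hz⟩ := (S.bijective_right y.1).2 x.1
      have hz' : (S.r (z, y.1)).2 = x.1 := hz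
      exact ⟨⟨z, (hγ z y.1).1 (hz' ▸ x.2)⟩, Subtype.ext hz⟩
  braid p := by
    have h := S.braid (p.1.1, p.2.1.1, p.2.2.1)
    have h1 := congrArg (fun q => q.1) h
    have h2 := congrArg (fun q => q.2.1) h
    have h3 := congrArg (fun q => q.2.2) h
    exact Prod.ext (Subtype.ext h1) (Prod.ext (Subtype.ext h2) (Subtype.ext h3))

end YBESolution

namespace LeftBrace

variable (B : Type*) [LeftBrace B]

/-- The map `γ_b (a) = λ_{λ_a (b)}⁻¹ (a)`. -/
def gam (b a : B) : B := (lam (lam a b)).symm a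

variable {B}

theorem lam_mul_gam (a b : B) : lam a b * gam B b a = a * b := by
  rw [gam, gam_eq, mul_inv_cancel_left]

theorem gam_mul (a b c : B) : gam B c (gam B b a) = gam B (b * c) a := by
  have h1 : lam a (b * c) = lam a b * lam (gam B b a) c := by
    rw [← add_lam b c, map_add, ← add_lam (lam a b), ← lam_mul (lam a b), lam_mul_gam, lam_mul]
  have h2 : gam B c (gam B b a) = (lam (gam B b a) c)⁻¹ * (gam B b a * c) := gam_eq _ _
  have h3 : gam B (b * c) a = (lam a (b * c))⁻¹ * (a * (b * c)) := gam_eq _ _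
  rw [h2, h3, h1, mul_inv_rev, mul_assoc, ← mul_assoc a b c, ← lam_mul_gam a b, mul_assoc,
    inv_mul_cancel_left]

theorem gam_one (a : B) : gam B 1 a = a := by
  have h : gam B 1 a = (lam a 1)⁻¹ * (a * 1) := gam_eq _ _
  rw [h, mul_one, one_eq_zero, map_zero, ← one_eq_zero, inv_one, one_mul]

variable (B)

/-- The solution `r_B (a, b) = (λ_a (b), λ_{λ_a (b)}⁻¹ (a))` associated to a left brace. -/
def solution : YBESolution B where
  r p := (lam p.1 p.2, (lam (lam p.1 p.2)).symm p.1)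
  involutive p := by
    obtain ⟨a, b⟩ := p
    have h : lam (lam a b) ((lam (lam a b)).symm a) = a := AddEquiv.apply_symm_apply _ _
    refine Prod.ext h ?_
    change (lam (lam (lam a b) ((lam (lam a b)).symm a))).symm (lam a b) = b
    rw [h, AddEquiv.symm_apply_apply]
  bijective_left x := (lam x).bijective
  bijective_right y := by
    change Function.Bijective fun x => gam B y x
    refine Function.bijective_iff_has_inverse.2 ⟨fun x => gam B y⁻¹ x, fun x => ?_, fun x => ?_⟩
    · change gam B y⁻¹ (gam B y x) = x
      rw [gam_mul, mul_inv_cancel, gam_one]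
    · change gam B y (gam B y⁻¹ x) = x
      rw [gam_mul, inv_mul_cancel, gam_one]
  braid p := by
    obtain ⟨a, b, c⟩ := p
    change (lam (lam a b) (lam (gam B b a) c), gam B (lam (gam B b a) c) (lam a b),
        gam B c (gam B b a)) =
      (lam a (lam b c), lam (gam B (lam b c) a) (gam B c b), gam B (gam B c b) (gam B (lam b c) a))
    have e1 : lam (lam a b) (lam (gam B b a) c) = lam a (lam b c) := by
      rw [← lam_mul, lam_mul_gam, lam_mul]
    have e3 : gam B c (gam B b a) = gam B (gam B c b) (gam B (lam b c) a) := by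
      rw [gam_mul, gam_mul, lam_mul_gam]
    have e2 : gam B (lam (gam B b a) c) (lam a b) = lam (gam B (lam b c) a) (gam B c b) := by
      have l : lam (lam a b) (lam (gam B b a) c) * gam B (lam (gam B b a) c) (lam a b) *
          gam B c (gam B b a) = a * b * c := by
        rw [lam_mul_gam, mul_assoc, lam_mul_gam, ← mul_assoc, lam_mul_gam]
      have r : lam a (lam b c) * lam (gam B (lam b c) a) (gam B c b) *
          gam B (gam B c b) (gam B (lam b c) a) = a * b * c := by
        rw [mul_assoc, lam_mul_gam, ← mul_assoc, lam_mul_gam, mul_assoc, lam_mul_gam, ← mul_assoc]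
      rw [← r, e1, e3] at l
      exact mul_left_cancel (mul_right_cancel l)
    rw [e1, e2, e3]

end LeftBrace

/-! ### Asymmetric products -/

/-- The data of an asymmetric product of the trivial brace on an abelian group `H` by a left brace
`S`: an action `α` of the multiplicative group of `S` on `H` and a symmetric bi-additive map
`b : H × H → S` with `λ_s (b (f, h)) = b (α_s f, α_s h)`. -/
structure AsymData (H S : Type*) [AddCommGroup H] [LeftBrace S] where
  α : S → H ≃+ H
  α_mul : ∀ s u h, α (s * u) h = α s (α u h)
  b : H → H → S
  b_add : ∀ f g h, b (f + g) h = b f h + b g h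
  b_symm : ∀ f h, b f h = b h f
  lam_b : ∀ s f h, LeftBrace.lam s (b f h) = b (α s f) (α s h)

/-- The underlying set `H × S` of the asymmetric product. -/
@[ext]
structure AsymData.Product {H S : Type*} [AddCommGroup H] [LeftBrace S] (D : AsymData H S) where
  fst : H
  snd : S

namespace AsymData

variable {H S : Type*} [AddCommGroup H] [LeftBrace S] (D : AsymData H S)

theorem add_b (f g h : H) : D.b f (g + h) = D.b f g + D.b f h := by
  rw [D.b_symm, D.b_add, D.b_symm g, D.b_symm h]

theorem zero_b (h : H) : D.b 0 h = 0 := by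
  have e := D.b_add 0 0 h
  rw [add_zero] at e
  exact left_eq_add.1 e

theorem b_zero (h : H) : D.b h 0 = 0 := by rw [D.b_symm, D.zero_b]

theorem neg_b (f h : H) : D.b (-f) h = -D.b f h := by
  have e := D.b_add (-f) f h
  rw [neg_add_cancel, zero_b] at e
  exact eq_neg_of_add_eq_zero_left e.symm

theorem α_one (h : H) : D.α 1 h = h := by
  apply (D.α 1).injective
  rw [← D.α_mul, one_mul]

theorem α_inv_α (s : S) (h : H) : D.α s⁻¹ (D.α s h) = h := by
  rw [← D.α_mul, inv_mul_cancel, α_one]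

namespace Product

variable {D}

instance : Add D.Product := ⟨fun p q => ⟨p.fst + q.fst, p.snd + q.snd + D.b p.fst q.fst⟩⟩
instance : Zero D.Product := ⟨⟨0, 0⟩⟩
instance : Neg D.Product := ⟨fun p => ⟨-p.fst, -p.snd + D.b p.fst p.fst⟩⟩
instance : Mul D.Product := ⟨fun p q => ⟨p.fst + D.α p.snd q.fst, p.snd * q.snd⟩⟩
instance : One D.Product := ⟨⟨0, 1⟩⟩
instance : Inv D.Product := ⟨fun p => ⟨-D.α p.snd⁻¹ p.fst, p.snd⁻¹⟩⟩

@[simp] theorem add_fst (p q : D.Product) : (p + q).fst = p.fst + q.fst := rfl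
@[simp] theorem add_snd (p q : D.Product) :
    (p + q).snd = p.snd + q.snd + D.b p.fst q.fst := rfl
@[simp] theorem zero_fst : (0 : D.Product).fst = 0 := rfl
@[simp] theorem zero_snd : (0 : D.Product).snd = 0 := rfl
@[simp] theorem neg_fst (p : D.Product) : (-p).fst = -p.fst := rfl
@[simp] theorem neg_snd (p : D.Product) : (-p).snd = -p.snd + D.b p.fst p.fst := rfl
@[simp] theorem mul_fst (p q : D.Product) : (p * q).fst = p.fst + D.α p.snd q.fst := rfl
@[simp] theorem mul_snd (p q : D.Product) : (p * q).snd = p.snd * q.snd := rfl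
@[simp] theorem one_fst : (1 : D.Product).fst = 0 := rfl
@[simp] theorem one_snd : (1 : D.Product).snd = 1 := rfl
@[simp] theorem inv_fst (p : D.Product) : (p⁻¹).fst = -D.α p.snd⁻¹ p.fst := rfl
@[simp] theorem inv_snd (p : D.Product) : (p⁻¹).snd = p.snd⁻¹ := rfl

instance : AddCommGroup D.Product where
  add_assoc p q w := by
    ext
    · simp [add_assoc]
    · simp only [add_snd, add_fst, D.b_add, D.add_b]; abel
  zero_add p := by ext <;> simp [D.zero_b]
  add_zero p := by ext <;> simp [D.b_zero]
  nsmul := nsmulRec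
  zsmul := zsmulRec
  neg_add_cancel p := by
    ext
    · simp
    · simp only [add_snd, neg_snd, neg_fst, D.neg_b, zero_snd]; abel
  add_comm p q := by
    ext
    · simp [add_comm]
    · simp only [add_snd]; rw [D.b_symm, add_comm p.snd]

instance : Group D.Product :=
  Group.ofLeftAxioms
    (by
      intro p q w
      ext
      · simp [D.α_mul, add_assoc]
      · simp [mul_assoc])
    (by
      intro p
      ext <;> simp [D.α_one])
    (by
      intro p
      ext <;> simp)

/-- The asymmetric product `H ⋊∘ S`: its multiplicative group is the semidirect product
`H ⋊_α S`, and `(f, s) + (h, u) = (f + h, s + u + b (f, h))`. -/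
instance : LeftBrace D.Product where
  brace_eq p q w := by
    ext
    · simp only [add_fst, mul_fst, map_add]; abel
    · simp only [add_snd, mul_snd, add_fst, mul_fst, map_add, D.b_add, D.add_b]
      have h := LeftBrace.add_lam p.snd (D.b q.fst w.fst)
      rw [LeftBrace.mul_add', LeftBrace.mul_add', ← h, D.lam_b, D.b_symm p.fst (D.α p.snd w.fst)]
      abel

end Product

end AsymData

/-! ### The construction -/

/-- The underlying set `A × T` of `A₁ = A ⋊ T`, where `T = ⟨t⟩`. Automorphisms of the abelian group
`A` are written as `ℤ`-linear automorphisms. -/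
@[ext]
structure SemiBrace {A : Type*} [AddCommGroup A] (t : A ≃ₗ[ℤ] A) where
  fst : A
  snd : Subgroup.zpowers t

namespace SemiBrace

variable {A : Type*} [AddCommGroup A] {t : A ≃ₗ[ℤ] A}

instance : Add (SemiBrace t) := ⟨fun p q => ⟨p.fst + q.fst, p.snd * q.snd⟩⟩
instance : Zero (SemiBrace t) := ⟨⟨0, 1⟩⟩
instance : Neg (SemiBrace t) := ⟨fun p => ⟨-p.fst, p.snd⁻¹⟩⟩
instance : Mul (SemiBrace t) := ⟨fun p q => ⟨p.fst + p.snd.1 q.fst, p.snd * q.snd⟩⟩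
instance : One (SemiBrace t) := ⟨⟨0, 1⟩⟩
instance : Inv (SemiBrace t) := ⟨fun p => ⟨-p.snd.1⁻¹ p.fst, p.snd⁻¹⟩⟩

@[simp] theorem add_fst (p q : SemiBrace t) : (p + q).fst = p.fst + q.fst := rfl
@[simp] theorem add_snd (p q : SemiBrace t) : (p + q).snd = p.snd * q.snd := rfl
@[simp] theorem zero_fst : (0 : SemiBrace t).fst = 0 := rfl
@[simp] theorem zero_snd : (0 : SemiBrace t).snd = 1 := rfl
@[simp] theorem neg_fst (p : SemiBrace t) : (-p).fst = -p.fst := rfl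
@[simp] theorem neg_snd (p : SemiBrace t) : (-p).snd = p.snd⁻¹ := rfl
@[simp] theorem mul_fst (p q : SemiBrace t) : (p * q).fst = p.fst + p.snd.1 q.fst := rfl
@[simp] theorem mul_snd (p q : SemiBrace t) : (p * q).snd = p.snd * q.snd := rfl
@[simp] theorem one_fst : (1 : SemiBrace t).fst = 0 := rfl
@[simp] theorem one_snd : (1 : SemiBrace t).snd = 1 := rfl
@[simp] theorem inv_fst (p : SemiBrace t) : (p⁻¹).fst = -p.snd.1⁻¹ p.fst := rfl
@[simp] theorem inv_snd (p : SemiBrace t) : (p⁻¹).snd = p.snd⁻¹ := rfl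

theorem zpowers_comm (u v : Subgroup.zpowers t) : u * v = v * u := by
  obtain ⟨_, z, rfl⟩ := u
  obtain ⟨_, w, rfl⟩ := v
  exact Subtype.ext (zpow_mul_comm t z w)

instance : AddCommGroup (SemiBrace t) where
  add_assoc p q w := by ext1 <;> simp [add_assoc, mul_assoc]
  zero_add p := by ext1 <;> simp
  add_zero p := by ext1 <;> simp
  nsmul := nsmulRec
  zsmul := zsmulRec
  neg_add_cancel p := by ext1 <;> simp
  add_comm p q := by
    ext1
    · exact add_comm _ _
    · exact zpowers_comm _ _

instance : Group (SemiBrace t) :=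
  Group.ofLeftAxioms
    (by
      intro p q w
      ext1
      · simp only [mul_fst, mul_snd, map_add, add_assoc]
        rfl
      · simp [mul_assoc])
    (by
      intro p
      ext1
      · simp only [mul_fst, one_fst, one_snd, zero_add]
        rfl
      · simp)
    (by
      intro p
      ext1
      · simp only [mul_fst, inv_fst, inv_snd, one_fst]
        exact neg_add_cancel _
      · simp)

/-- The left brace `A₁ = A ⋊ T`, the semidirect product of the trivial left braces on `A` and `T`:
`(a, u) + (c, v) = (a + c, u v)` and `(a, u) (c, v) = (a + u c, u v)`. -/
instance : LeftBrace (SemiBrace t) where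
  brace_eq p q w := by
    ext1
    · simp only [add_fst, mul_fst, map_add]; abel
    · simp only [add_snd, mul_snd]
      rw [mul_assoc, mul_assoc, mul_assoc, zpowers_comm p.snd w.snd]

theorem lam_eq (p : SemiBrace t) (a : A) :
    LeftBrace.lam p ⟨a, 1⟩ = ⟨p.snd.1 a, 1⟩ := by
  rw [LeftBrace.lam_apply]
  ext1
  · simp
  · simp

end SemiBrace

/-- The `ℤ/n`-module structure of an abelian group of exponent `n`. -/
@[reducible] noncomputable def exponentModule (A : Type*) [AddCommGroup A] :
    Module (ZMod (AddMonoid.exponent A)) A :=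
  AddCommGroup.zmodModule AddMonoid.exponent_nsmul_eq_zero

/-- An abelian group `A`, an automorphism `t` of `A` such that `t - id` is an automorphism as well,
and a family `(j_a)` of elements of `A` with `j_a = j_{-a}` and
`j_{t^z (a)} = t^z (j_a) - (t^z - id) (j_0)` for all `z ∈ ℤ`. -/
structure JFamily (A : Type*) [AddCommGroup A] where
  t : A ≃ₗ[ℤ] A
  sub_bijective : Function.Bijective fun a => t a - a
  j : A → A
  j_neg : ∀ a, j a = j (-a)
  j_zpow : ∀ (a : A) (z : ℤ), j ((t ^ z) a) = (t ^ z) (j a) - ((t ^ z) (j 0) - j 0)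

namespace JFamily

variable {A : Type*} [AddCommGroup A] (D : JFamily A)

/-- The automorphism `t - id`. -/
noncomputable def tSub : A ≃ₗ[ℤ] A :=
  LinearEquiv.ofBijective (D.t.toLinearMap - LinearMap.id) D.sub_bijective

theorem tSub_apply (a : A) : D.tSub a = D.t a - a := rfl

/-- The group `T` generated by `t`. -/
abbrev T : Subgroup (A ≃ₗ[ℤ] A) := Subgroup.zpowers D.t

theorem t_comm (u : D.T) (a : A) : D.t (u.1 a) = u.1 (D.t a) := by
  have h := SemiBrace.zpowers_comm ⟨D.t, Subgroup.mem_zpowers D.t⟩ u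
  have h' := congrArg Subtype.val h
  exact congrArg (fun f : A ≃ₗ[ℤ] A => f a) h'

theorem tSub_symm_comm (u : D.T) (a : A) : D.tSub.symm (u.1 a) = u.1 (D.tSub.symm a) := by
  rw [LinearEquiv.symm_apply_eq, tSub_apply, t_comm, ← map_sub, ← tSub_apply,
    LinearEquiv.apply_symm_apply]

/-- The element `(t - id)⁻² (u t - t) (j_0)`, for `u ∈ T`. -/
noncomputable def shift (u : D.T) : A :=
  D.tSub.symm (D.tSub.symm (u.1 (D.t (D.j 0)) - D.t (D.j 0)))

theorem shift_mul (u v : D.T) : D.shift (u * v) = D.shift u + u.1 (D.shift v) := by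
  have h : (u * v).1 (D.t (D.j 0)) - D.t (D.j 0) =
      (u.1 (D.t (D.j 0)) - D.t (D.j 0)) + u.1 (v.1 (D.t (D.j 0)) - D.t (D.j 0)) := by
    rw [map_sub]
    change u.1 (v.1 (D.t (D.j 0))) - _ = _
    abel
  rw [shift, h, map_add, map_add, tSub_symm_comm, tSub_symm_comm]
  rfl

/-- The left brace `A₁ = A ⋊ T`. -/
abbrev A₁ : Type _ := SemiBrace D.t

/-- The bijection `g_{(a, u)} (x) = u⁻¹ (x - a - (t - id)⁻² (u t - t) (j_0))` of `A`, for
`u = t^z ∈ T`. -/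
noncomputable def g (p : D.A₁) : Equiv.Perm A where
  toFun x := p.snd.1⁻¹ (x - p.fst - D.shift p.snd)
  invFun x := p.snd.1 x + p.fst + D.shift p.snd
  left_inv x := by
    have h : ∀ y, p.snd.1 (p.snd.1⁻¹ y) = y := fun y => LinearEquiv.apply_symm_apply p.snd.1 y
    change p.snd.1 (p.snd.1⁻¹ (x - p.fst - D.shift p.snd)) + p.fst + D.shift p.snd = x
    rw [h]; abel
  right_inv x := by
    have h : ∀ y, p.snd.1⁻¹ (p.snd.1 y) = y := fun y => LinearEquiv.symm_apply_apply p.snd.1 y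
    change p.snd.1⁻¹ (p.snd.1 x + p.fst + D.shift p.snd - p.fst - D.shift p.snd) = x
    have e : p.snd.1 x + p.fst + D.shift p.snd - p.fst - D.shift p.snd = p.snd.1 x := by abel
    rw [e, h]

theorem g_symm_apply (p : D.A₁) (x : A) :
    (D.g p).symm x = p.snd.1 x + p.fst + D.shift p.snd := rfl

theorem g_symm_mul (p q : D.A₁) (x : A) : (D.g (p * q)).symm x = (D.g p).symm ((D.g q).symm x) := by
  simp only [g_symm_apply, SemiBrace.mul_fst, SemiBrace.mul_snd, shift_mul, map_add]
  change p.snd.1 (q.snd.1 x) + _ + _ = _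
  abel

/-- The group `H'` of finitely supported functions `A → ℤ/n`, where `n` is the exponent of `A`. -/
abbrev H' (_D : JFamily A) : Type _ := A →₀ ZMod (AddMonoid.exponent A)

/-- The action `α' (p) (f) = f ∘ g_p` of `A₁` on `H'`. -/
noncomputable def α' (p : D.A₁) : D.H' ≃+ D.H' := Finsupp.domCongr (D.g p).symm

theorem α'_apply (p : D.A₁) (f : D.H') (x : A) : D.α' p f x = f (D.g p x) := rfl

theorem α'_mul (p q : D.A₁) (f : D.H') : D.α' (p * q) f = D.α' p (D.α' q f) := by
  ext x
  rw [α'_apply, α'_apply, α'_apply]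
  congr 1
  rw [← Equiv.eq_symm_apply, g_symm_mul, Equiv.symm_apply_apply, Equiv.symm_apply_apply]

attribute [local instance] exponentModule in
/-- The sum `∑_{x, y ∈ A} f (x) h (y) t (j_{x - y} - j_0)`. -/
noncomputable def pairing (f h : D.H') : A :=
  f.sum fun x m => h.sum fun y k => (m * k) • D.t (D.j (x - y) - D.j 0)

attribute [local instance] exponentModule in
theorem pairing_add (f f' h : D.H') : D.pairing (f + f') h = D.pairing f h + D.pairing f' h := by
  classical
  refine Finsupp.sum_add_index' (fun x => ?_) (fun x m m' => ?_)
  · simp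
  · rw [← Finsupp.sum_add]
    simp only [add_mul, add_smul]

attribute [local instance] exponentModule in
theorem pairing_symm (f h : D.H') : D.pairing f h = D.pairing h f := by
  rw [pairing, pairing, Finsupp.sum_comm]
  refine Finsupp.sum_congr fun y _ => Finsupp.sum_congr fun x _ => ?_
  rw [mul_comm, D.j_neg, neg_sub]

theorem t_j (u : D.T) (a : A) : D.j (u.1 a) - D.j 0 = u.1 (D.j a - D.j 0) := by
  obtain ⟨_, z, rfl⟩ := u
  change D.j ((D.t ^ z) a) - D.j 0 = (D.t ^ z) (D.j a - D.j 0)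
  rw [D.j_zpow, map_sub]; abel

attribute [local instance] exponentModule in
theorem pairing_α' (p : D.A₁) (f h : D.H') :
    D.pairing (D.α' p f) (D.α' p h) = p.snd.1 (D.pairing f h) := by
  have es : ∀ (f : D.H') (F : A → ZMod (AddMonoid.exponent A) → A),
      (D.α' p f).sum F = f.sum fun x m => F ((D.g p).symm x) m := by
    intro f F
    exact Finsupp.sum_equivMapDomain (D.g p).symm f F
  rw [pairing, es, pairing, map_finsuppSum]
  refine Finsupp.sum_congr fun x _ => ?_
  rw [es, map_finsuppSum]
  refine Finsupp.sum_congr fun y _ => ?_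
  rw [ZMod.map_smul p.snd.1, ← t_comm, ← t_j, g_symm_apply, g_symm_apply, map_sub p.snd.1,
    add_sub_add_right_eq_sub, add_sub_add_right_eq_sub]

/-- The bilinear form `b' (f, h) = (∑_{x, y ∈ A} f (x) h (y) t (j_{x - y} - j_0), id)`. -/
noncomputable def b' (f h : D.H') : D.A₁ := ⟨D.pairing f h, 1⟩

/-- The data `(α', b')` of the asymmetric product. -/
noncomputable def asymData : AsymData D.H' D.A₁ where
  α := D.α'
  α_mul := D.α'_mul
  b := D.b'
  b_add f f' h := by
    refine SemiBrace.ext (D.pairing_add f f' h) ?_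
    exact (mul_one _).symm
  b_symm f h := SemiBrace.ext (D.pairing_symm f h) rfl
  lam_b p f h := by
    rw [b', SemiBrace.lam_eq, b', pairing_α']

/-- The left brace `B' = H' ⋊∘ A₁`. -/
abbrev B' : Type _ := D.asymData.Product

/-- The element `x'_{(a, c)} = (e'_a, (c - t (t - id)⁻¹ (j_0), t))` of `B'`, where `e'_a` is the
indicator function of `a`. -/
noncomputable def x' (a c : A) : D.B' :=
  ⟨Finsupp.single a 1, ⟨c - D.t (D.tSub.symm (D.j 0)), ⟨D.t, Subgroup.mem_zpowers D.t⟩⟩⟩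

/-- The set `X' = {x'_{(a, c)} | a, c ∈ A}`. -/
def X' : Set D.B' := {x | ∃ a c : A, x = D.x' a c}

theorem mem_X'_iff (q : D.B') :
    q ∈ D.X' ↔ (∃ a, q.fst = Finsupp.single a 1) ∧
      q.snd.snd = ⟨D.t, Subgroup.mem_zpowers D.t⟩ := by
  constructor
  · rintro ⟨a, c, rfl⟩
    exact ⟨⟨a, rfl⟩, rfl⟩
  · rintro ⟨⟨a, ha⟩, hq⟩
    refine ⟨a, q.snd.fst + D.t (D.tSub.symm (D.j 0)), ?_⟩
    refine AsymData.Product.ext ha (SemiBrace.ext ?_ hq)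
    exact (add_sub_cancel_right _ _).symm

theorem lam_mem_X' (p q : D.B') (hq : q ∈ D.X') : LeftBrace.lam p q ∈ D.X' := by
  rw [mem_X'_iff] at hq ⊢
  obtain ⟨⟨a, ha⟩, hq⟩ := hq
  rw [LeftBrace.lam_apply]
  refine ⟨⟨(D.g p.snd).symm a, ?_⟩, ?_⟩
  · rw [AsymData.Product.add_fst, AsymData.Product.neg_fst, AsymData.Product.mul_fst,
      neg_add_cancel_left, ha]
    exact Finsupp.equivMapDomain_single _ _ _
  · rw [← hq]
    change p.snd.snd⁻¹ * 1 * (p.snd.snd * q.snd.snd) * 1 = q.snd.snd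
    group

theorem lam_mem_X'_iff (p q : D.B') : LeftBrace.lam p q ∈ D.X' ↔ q ∈ D.X' := by
  refine ⟨fun h => ?_, D.lam_mem_X' p q⟩
  have := D.lam_mem_X' p⁻¹ _ h
  rwa [LeftBrace.lam_inv_lam] at this

/-- The solution `(X', r')`, the restriction to `X'` of the solution associated to `B'`. -/
noncomputable def solution : YBESolution D.X' :=
  (LeftBrace.solution D.B').restrict D.X' (fun p q => D.lam_mem_X'_iff p q)
    (fun p q => D.lam_mem_X'_iff (LeftBrace.lam p q)⁻¹ p)

end JFamily

/-! The first isomorphism is a general fact about a left brace `B` and a subset `X` that is stable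
under all lambda maps and generates `(B, +)`. Restricting `λ_g` to `X` gives a group homomorphism
whose kernel is the socle, since an additive map fixing a generating set is the identity. Its image
is the permutation group, because `X` then also generates `(B, *)`. It is additive because in both
braces adding a generator is the multiplicative operation `g + x = g * λ_g⁻¹ (x)`. Hence `B / soc B`
is the permutation group (`nonempty_quotient_socle_equiv`).

For `B'` the coprimality is what makes `X'` generate (`closure_X'`). Differences of elements of `X'`
give all of `A`, which contains the values of `b'`, so modulo `A` the question takes place in the
ordinary product `H' × T`. There `n (e_0, t) = (0, t^n)`, and `t` is a power of `t^n`. The socle is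
read off from the explicit lambda map (`lam_eq`, `mem_socle_iff`).

If `b'` is non-singular, the socle is trivial and `B'` is its own quotient. Conversely, suppose `B'
≅ B' / soc B'` and let `f` be in the radical of `b'`. For finite `A` the brace is finite, and
counting kills the socle. Infinite `A` is excluded when `f ≠ 0`: the finiteness of `T` gives every
socle element of `B' / soc B'` a finite lambda orbit (`finite_range_lam_quotient_socle`), while the
orbit of the socle element `(f, 0)` of `B'` contains all translates of `f`, which are infinitely
many. -/

namespace LeftBrace

variable {B : Type*} [LeftBrace B]

/-! ### Lambda maps, socles and generating sets in a general left brace -/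

theorem map_lam {C : Type*} [LeftBrace C] (e : B ≃+* C) (a b : B) :
    e (lam a b) = lam (e a) (e b) := by
  refine add_left_cancel (a := e a) ?_
  rw [← _root_.map_add, add_lam, add_lam, _root_.map_mul]

theorem mem_socle_iff {a : B} : a ∈ (socle B).toSubgroup ↔ ∀ b, lam a b = b :=
  mul_eq_add_iff a

theorem map_mem_socle {C : Type*} [LeftBrace C] (e : B ≃+* C) {a : B}
    (ha : a ∈ (socle B).toSubgroup) : e a ∈ (socle C).toSubgroup := by
  rw [mem_socle_iff] at ha ⊢
  intro c
  obtain ⟨b, rfl⟩ := e.surjective c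
  rw [← map_lam, ha]

/-- Converts additive inverses into multiplicative ones: taken at `a = -y`, it shows that `-y` is
the multiplicative inverse of a lambda image of `y`. -/
theorem inv_eq_neg_lam (a : B) : a⁻¹ = -lam a⁻¹ a := by
  rw [lam_apply, inv_mul_cancel, one_eq_zero, add_zero, neg_neg]

theorem Ideal.toQuot_lam (I : Ideal B) (a b : B) :
    I.toQuot (lam a b) = lam (I.toQuot a) (I.toQuot b) := rfl

/-- A `λ`-stable set that generates the additive group of a left brace also generates the
multiplicative group. -/
theorem closure_eq_top_of_addClosure_eq_top {X : Set B} (hX : ∀ p q, q ∈ X → lam p q ∈ X)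
    (hgen : AddSubgroup.closure X = ⊤) : Subgroup.closure X = ⊤ := by
  refine (Subgroup.eq_top_iff' _).2 fun g => ?_
  have hg : g ∈ AddSubgroup.closure X := by rw [hgen]; trivial
  induction hg using AddSubgroup.closure_induction_right with
  | zero =>
    rw [← one_eq_zero]
    exact one_mem _
  | add_right g _ x hx ih =>
    rw [add_eq_mul_lam]
    exact mul_mem ih (Subgroup.subset_closure (hX _ _ hx))
  | add_neg_cancel g _ x hx ih =>
    -- With `y = λ_g⁻¹ (x)` in `X`, this gives `g - x = g * (-y)`, and `-y` is the inverse of `λ_w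
    -- (y)` for `w = (-y)⁻¹`, again an element of `X`.
    rw [add_eq_mul_lam, _root_.map_neg, ← inv_inv (-lam g⁻¹ x), inv_eq_neg_lam (-lam g⁻¹ x),
      _root_.map_neg, neg_neg]
    exact mul_mem ih (inv_mem (Subgroup.subset_closure (hX _ _ (hX _ _ hx))))

/-! ### The permutation group of a stable generating set as the quotient by the socle -/

section Restrict

variable {X : Set B}

/-- The action of a left brace on a `λ`-stable subset. -/
def lamPerm (hX : ∀ p q, q ∈ X → lam p q ∈ X) : B →* Equiv.Perm X where
  toFun g :=
    { toFun := fun q => ⟨lam g q, hX _ _ q.2⟩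
      invFun := fun q => ⟨lam g⁻¹ q, hX _ _ q.2⟩
      left_inv := fun q => Subtype.ext (lam_inv_lam g q)
      right_inv := fun q => Subtype.ext (lam_lam_inv g q) }
  map_one' := Equiv.ext fun q => Subtype.ext (lam_one q.1)
  map_mul' g h := Equiv.ext fun q => Subtype.ext (lam_mul g h q.1)

/-- `λ_g` is an additive endomorphism, so its values on additive generators determine it, and the
socle is exactly the kernel of `λ`. -/
theorem lamPerm_eq_one_iff (hX : ∀ p q, q ∈ X → lam p q ∈ X)
    (hgen : AddSubgroup.closure X = ⊤) (g : B) :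
    lamPerm hX g = 1 ↔ g ∈ (socle B).toSubgroup := by
  rw [mem_socle_iff]
  refine ⟨fun h => ?_, fun h => Equiv.ext fun q => Subtype.ext (h q)⟩
  have e : (lam g).toAddMonoidHom = AddMonoidHom.id B :=
    AddMonoidHom.eq_of_eqOn_dense hgen fun x hx => by
      exact congrArg Subtype.val (Equiv.congr_fun h ⟨x, hx⟩)
  exact fun b => DFunLike.congr_fun e b

variable (hσ : ∀ x y, ((solution B).r (x, y)).1 ∈ X ↔ y ∈ X)
  (hγ : ∀ x y, ((solution B).r (x, y)).2 ∈ X ↔ x ∈ X)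

theorem lamPerm_coe (x : X) :
    lamPerm (fun p q => (hσ p q).2) x = ((solution B).restrict X hσ hγ).sigma x :=
  Equiv.ext fun _ => rfl

theorem range_lamPerm (hgen : AddSubgroup.closure X = ⊤) :
    (lamPerm fun p q => (hσ p q).2).range =
      Subgroup.closure (Set.range ((solution B).restrict X hσ hγ).sigma) := by
  rw [MonoidHom.range_eq_map,
    ← closure_eq_top_of_addClosure_eq_top (fun p q => (hσ p q).2) hgen, MonoidHom.map_closure]
  congr 1
  ext f
  constructor
  · rintro ⟨x, hx, rfl⟩
    exact ⟨⟨x, hx⟩, (lamPerm_coe hσ hγ ⟨x, hx⟩).symm⟩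
  · rintro ⟨x, rfl⟩
    exact ⟨x, x.2, lamPerm_coe hσ hγ x⟩

/-- The homomorphism `g ↦ λ_g` from a left brace to the permutation group of the solution on a
`λ`-stable set of generators. -/
noncomputable def toPermGroup (hgen : AddSubgroup.closure X = ⊤) :
    B →* ((solution B).restrict X hσ hγ).PermGroup :=
  (lamPerm fun p q => (hσ p q).2).codRestrict
    (Subgroup.closure (Set.range ((solution B).restrict X hσ hγ).sigma)) fun g => by
      rw [← range_lamPerm hσ hγ hgen]
      exact ⟨g, rfl⟩

theorem toPermGroup_coe (hgen : AddSubgroup.closure X = ⊤) (x : X) :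
    toPermGroup hσ hγ hgen x = YBESolution.PermGroup.of ((solution B).restrict X hσ hγ) x :=
  Subtype.ext (lamPerm_coe hσ hγ x)

theorem toPermGroup_surjective (hgen : AddSubgroup.closure X = ⊤) :
    Function.Surjective (toPermGroup hσ hγ hgen) := by
  rintro ⟨f, hf⟩
  rw [← range_lamPerm hσ hγ hgen] at hf
  obtain ⟨g, hg⟩ := hf
  exact ⟨g, Subtype.ext hg⟩

theorem toPermGroup_eq_one_iff (hgen : AddSubgroup.closure X = ⊤) (g : B) :
    toPermGroup hσ hγ hgen g = 1 ↔ g ∈ (socle B).toSubgroup := by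
  rw [← lamPerm_eq_one_iff (fun p q => (hσ p q).2) hgen]
  exact Subtype.ext_iff

theorem toPermGroup_eq_iff (hgen : AddSubgroup.closure X = ⊤) (g h : B) :
    toPermGroup hσ hγ hgen g = toPermGroup hσ hγ hgen h ↔
      (socle B).toQuot g = (socle B).toQuot h := by
  rw [Ideal.toQuot_eq_iff, ← toPermGroup_eq_one_iff hσ hγ hgen, _root_.map_mul, _root_.map_inv,
    inv_mul_eq_one]

/-- In the permutation group, adding a generator is right multiplication by the generator translated
by `g⁻¹`. In `B` the same rule is `add_eq_mul_lam`, so multiplicativity suffices here. -/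
theorem toPermGroup_add_coe (hgen : AddSubgroup.closure X = ⊤) (g : B) (x : X) :
    toPermGroup hσ hγ hgen (g + x) = toPermGroup hσ hγ hgen g + toPermGroup hσ hγ hgen x := by
  set S := (solution B).restrict X hσ hγ
  have h := S.permGroupGenerated.add_ι (toPermGroup hσ hγ hgen g) x
  rw [YBESolution.GeneratedGroup.shift_apply] at h
  rw [toPermGroup_coe, add_eq_mul_lam, _root_.map_mul]
  refine Eq.trans ?_ h.symm
  rw [← _root_.map_inv]
  exact congrArg _ (toPermGroup_coe hσ hγ hgen ⟨lam g⁻¹ x, (hσ _ _).2 x.2⟩)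

theorem toPermGroup_add (hgen : AddSubgroup.closure X = ⊤) (g h : B) :
    toPermGroup hσ hγ hgen (g + h) = toPermGroup hσ hγ hgen g + toPermGroup hσ hγ hgen h := by
  have hh : h ∈ AddSubgroup.closure X := by rw [hgen]; trivial
  have h0 : toPermGroup hσ hγ hgen 0 = 0 := by
    rw [← one_eq_zero, _root_.map_one, one_eq_zero]
  -- The left summand has to vary: sums and negatives are treated by moving one term at a time into
  -- `g`.
  induction hh using AddSubgroup.closure_induction generalizing g with
  | mem x hx => exact toPermGroup_add_coe hσ hγ hgen g ⟨x, hx⟩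
  | zero => rw [h0, add_zero, add_zero]
  | add h k _ _ ih ik => rw [← add_assoc, ik, ih, ik h, add_assoc]
  | neg h _ ih =>
    have hs : ∀ g, toPermGroup hσ hγ hgen (g + -h) =
        toPermGroup hσ hγ hgen g - toPermGroup hσ hγ hgen h := fun g => by
      rw [eq_sub_iff_add_eq, ← ih, neg_add_cancel_right]
    -- Taking `g = 0` in the subtraction rule shows that negatives are preserved.
    have hn := hs 0
    rw [zero_add, h0, zero_sub] at hn
    rw [hs, hn, sub_eq_add_neg]

/-- The permutation group of the solution on a `λ`-stable set of generators of a left brace is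
the quotient by the socle. -/
theorem nonempty_quotient_socle_equiv (hgen : AddSubgroup.closure X = ⊤) :
    Nonempty ((socle B).Quotient ≃+* ((solution B).restrict X hσ hγ).PermGroup) := by
  let F : (socle B).Quotient → ((solution B).restrict X hσ hγ).PermGroup :=
    _root_.Quotient.lift (toPermGroup hσ hγ hgen) fun a b hab =>
      (toPermGroup_eq_iff hσ hγ hgen a b).2 (_root_.Quotient.sound hab)
  have hF : ∀ a, F ((socle B).toQuot a) = toPermGroup hσ hγ hgen a := fun _ => rfl
  have hbij : Function.Bijective F := by
    constructor
    · intro x y hxy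
      obtain ⟨a, rfl⟩ := (socle B).toQuot_surjective x
      obtain ⟨b, rfl⟩ := (socle B).toQuot_surjective y
      exact (toPermGroup_eq_iff hσ hγ hgen a b).1 hxy
    · intro f
      obtain ⟨g, rfl⟩ := toPermGroup_surjective hσ hγ hgen f
      exact ⟨(socle B).toQuot g, rfl⟩
  refine ⟨{ Equiv.ofBijective F hbij with
    map_mul' := fun x y => ?_
    map_add' := fun x y => ?_ }⟩
  · obtain ⟨a, rfl⟩ := (socle B).toQuot_surjective x
    obtain ⟨b, rfl⟩ := (socle B).toQuot_surjective y
    exact _root_.map_mul (toPermGroup hσ hγ hgen) a b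
  · obtain ⟨a, rfl⟩ := (socle B).toQuot_surjective x
    obtain ⟨b, rfl⟩ := (socle B).toQuot_surjective y
    exact toPermGroup_add hσ hγ hgen a b

end Restrict

/-! ### When a left brace is isomorphic to its quotient by the socle -/

/-- A left brace with trivial socle is isomorphic to its quotient by the socle. -/
theorem nonempty_equiv_quotient_socle (h : ∀ a ∈ (socle B).toSubgroup, a = 1) :
    Nonempty (B ≃+* (socle B).Quotient) := by
  have hbij : Function.Bijective (socle B).toQuot := by
    refine ⟨fun a b hab => ?_, (socle B).toQuot_surjective⟩
    rw [Ideal.toQuot_eq_iff] at hab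
    exact inv_mul_eq_one.1 (h _ hab)
  exact ⟨{ Equiv.ofBijective _ hbij with
    map_mul' := fun _ _ => rfl
    map_add' := fun _ _ => rfl }⟩

/-- A finite left brace that is isomorphic to its quotient by the socle has trivial socle. -/
theorem eq_one_of_mem_socle [Finite B] (e : B ≃+* (socle B).Quotient) {a : B}
    (ha : a ∈ (socle B).toSubgroup) : a = 1 := by
  -- This is a surjective self-map of a finite set, hence injective, and it sends `a` and `1` to the
  -- same element.
  have hs : Function.Surjective fun b => e.symm ((socle B).toQuot b) :=
    e.symm.surjective.comp (socle B).toQuot_surjective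
  refine (Finite.injective_iff_surjective.2 hs) (congrArg e.symm ?_)
  exact ((Ideal.toQuot_eq_iff _).2 (by simpa using ha)).symm

end LeftBrace
-- Explicit lambda maps and the socle of `B'`
theorem SemiBrace.lam_def {A : Type*} [AddCommGroup A] {t : A ≃ₗ[ℤ] A} (p q : SemiBrace t) :
    LeftBrace.lam p q = ⟨p.snd.1 q.fst, q.snd⟩ := by
  rw [LeftBrace.lam_apply]
  ext1
  · simp
  · simp

namespace AsymData

variable {H S : Type*} [AddCommGroup H] [LeftBrace S] (D : AsymData H S)

theorem Product.lam_def (p q : D.Product) :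
    LeftBrace.lam p q = ⟨D.α p.snd q.fst,
      LeftBrace.lam p.snd q.snd - D.b p.fst (D.α p.snd q.fst)⟩ := by
  rw [LeftBrace.lam_apply]
  ext1
  · simp
  · simp only [Product.add_snd, Product.neg_snd, Product.neg_fst, Product.mul_snd,
      Product.mul_fst, D.neg_b, D.add_b, LeftBrace.lam_apply]
    abel

end AsymData

namespace JFamily

variable {A : Type*} [AddCommGroup A] (D : JFamily A)

theorem b'_eq_zero_iff (f h : D.H') : D.b' f h = ⟨0, 1⟩ ↔ D.pairing f h = 0 :=
  ⟨fun e => congrArg SemiBrace.fst e, fun e => SemiBrace.ext e rfl⟩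

theorem shift_one : D.shift 1 = 0 := by
  have h : (1 : D.T).1 (D.t (D.j 0)) - D.t (D.j 0) = 0 := sub_self _
  rw [shift, h, map_zero, map_zero]

/-- The computational core. The `T`-coordinate is unchanged because `T` is a trivial brace, and `b'`
enters only through the `A`-coordinate. -/
theorem lam_eq (p q : D.B') :
    LeftBrace.lam p q = ⟨D.α' p.snd q.fst,
      ⟨p.snd.snd.1 q.snd.fst - D.pairing p.fst (D.α' p.snd q.fst), q.snd.snd⟩⟩ := by
  rw [AsymData.Product.lam_def]
  refine AsymData.Product.ext rfl ?_
  rw [SemiBrace.lam_def, sub_eq_add_neg]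
  refine SemiBrace.ext (sub_eq_add_neg _ _).symm ?_
  change q.snd.snd * 1⁻¹ = _
  simp

/-- The correction term in `g` vanishes for the trivial element of `T`, so `A` acts on `H'` by plain
translations. -/
theorem α'_translation (a : A) (f : D.H') (x : A) : D.α' ⟨a, 1⟩ f x = f (x - a) := by
  rw [α'_apply]
  congr 1
  change x - a - D.shift 1 = x - a
  rw [shift_one, sub_zero]

/-- If the translates of a finitely supported function take finitely many values, then the function
is zero or the group is finite. -/
theorem finite_of_finite_range_translation {f : D.H'} (hf : f ≠ 0)
    (h : (Set.range fun a => D.α' ⟨a, 1⟩ f).Finite) : Finite A := by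
  obtain ⟨x, hx⟩ := Finsupp.ne_iff.1 hf
  have hfin : (⋃ g ∈ Set.range fun a => D.α' ⟨a, 1⟩ f, (g.support : Set A)).Finite :=
    h.biUnion fun g _ => g.support.finite_toSet
  have huniv : (⋃ g ∈ Set.range fun a => D.α' ⟨a, 1⟩ f, (g.support : Set A)) = Set.univ := by
    -- Translating by `y - x` moves the point `x`, where `f` does not vanish, to `y`.
    refine Set.eq_univ_of_forall fun y => Set.mem_biUnion ⟨y - x, rfl⟩ ?_
    rw [Finset.mem_coe, Finsupp.mem_support_iff, α'_translation, sub_sub_cancel]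
    exact hx
  rw [huniv] at hfin
  exact Set.finite_univ_iff.1 hfin

/-- Membership means that `λ_x` is the identity. Elements `(h, 0)` detect the action on `H'` and the
radical of `b'`, elements `(0, (c, 1))` detect the `T`-coordinate, and an indicator function detects
the remaining translation. -/
theorem mem_socle_iff (hn : 1 < AddMonoid.exponent A) (x : D.B') :
    x ∈ (LeftBrace.socle D.B').toSubgroup ↔
      x.snd = ⟨0, 1⟩ ∧ ∀ h : D.H', D.pairing x.fst h = 0 := by
  have : Fact (1 < AddMonoid.exponent A) := ⟨hn⟩
  rw [LeftBrace.mem_socle_iff]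
  constructor
  · intro hx
    have hα : ∀ h, D.α' x.snd h = h := fun h => by
      have := congrArg AsymData.Product.fst (hx ⟨h, ⟨0, 1⟩⟩)
      rwa [lam_eq] at this
    have hb : ∀ h, D.pairing x.fst h = 0 := fun h => by
      have := congrArg (fun q => q.snd.fst) (hx ⟨h, ⟨0, 1⟩⟩)
      rw [lam_eq] at this
      dsimp only at this
      rwa [map_zero, zero_sub, neg_eq_zero, hα] at this
    have hu : x.snd.snd = 1 := by
      refine Subtype.ext (LinearEquiv.ext fun c => ?_)
      have := congrArg (fun q => q.snd.fst) (hx ⟨0, ⟨c, 1⟩⟩)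
      rw [lam_eq] at this
      dsimp only at this
      rwa [hα, hb, sub_zero] at this
    refine ⟨SemiBrace.ext ?_ hu, hb⟩
    have e : x.snd = ⟨x.snd.fst, 1⟩ := SemiBrace.ext rfl hu
    -- Translation by a nonzero element would move the indicator function of `0`. The values `0` and
    -- `1` differ in `ZMod n` because `n > 1`.
    have h0 := DFunLike.congr_fun (hα (Finsupp.single 0 1)) 0
    rw [e, α'_translation, zero_sub, Finsupp.single_eq_same] at h0
    by_contra hne
    rw [Finsupp.single_eq_of_ne (by simpa using hne)] at h0
    exact zero_ne_one h0
  · rintro ⟨hs, hb⟩ q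
    have hα : ∀ h, D.α' ⟨0, 1⟩ h = h := fun h => Finsupp.ext fun y => by
      rw [α'_translation, sub_zero]
    rw [lam_eq, hs, hα, hb, sub_zero]
    rfl

theorem finite_B' [Finite A] (hn : 1 < AddMonoid.exponent A) (ht : 0 < orderOf D.t) :
    Finite D.B' := by
  have : NeZero (AddMonoid.exponent A) := ⟨by omega⟩
  have : Finite D.T := (orderOf_pos_iff.1 ht).finite_zpowers
  have h1 : Finite D.A₁ := Finite.of_injective (fun p : D.A₁ => (p.fst, p.snd)) fun p q h =>
    SemiBrace.ext (congrArg Prod.fst h) (congrArg Prod.snd h)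
  have h2 : Finite D.H' := Finite.of_injective _ DFunLike.coe_injective
  exact Finite.of_injective (fun p : D.B' => (p.fst, p.snd)) fun p q h =>
    AsymData.Product.ext (congrArg Prod.fst h) (congrArg Prod.snd h)

theorem orderOf_t_pos (hn : 1 < AddMonoid.exponent A)
    (ht : Nat.Coprime (orderOf D.t) (AddMonoid.exponent A)) : 0 < orderOf D.t := by
  -- An element of infinite order has `orderOf` equal to `0`, which is coprime only to `1`.
  refine Nat.pos_of_ne_zero fun h => ?_
  rw [h, Nat.coprime_zero_left] at ht
  omega

/-! ### The socle of `B' / soc B'` and its lambda orbits -/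

theorem neg_add_fst (p q : D.B') : (-p + q).fst = -p.fst + q.fst := rfl

theorem pairing_neg (f h : D.H') : D.pairing (-f) h = -D.pairing f h :=
  congrArg SemiBrace.fst (D.asymData.neg_b f h)

theorem pairing_zero (f : D.H') : D.pairing f 0 = 0 :=
  congrArg SemiBrace.fst (D.asymData.b_zero f)

theorem neg_add_snd (p q : D.B') : (-p + q).snd =
    ⟨-p.snd.fst + D.pairing p.fst p.fst + q.snd.fst - D.pairing p.fst q.fst,
      p.snd.snd⁻¹ * q.snd.snd⟩ := by
  refine SemiBrace.ext ?_ ?_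
  · change -p.snd.fst + D.pairing p.fst p.fst + q.snd.fst + D.pairing (-p.fst) q.fst = _
    rw [pairing_neg, ← sub_eq_add_neg]
  · change p.snd.snd⁻¹ * 1 * q.snd.snd * 1 = _
    rw [mul_one, mul_one]

theorem pairing_α'_eq_zero {f : D.H'} (hf : ∀ h, D.pairing f h = 0) (p : D.A₁) (h : D.H') :
    D.pairing (D.α' p f) h = 0 := by
  obtain ⟨k, rfl⟩ := (D.α' p).surjective h
  rw [pairing_α', hf, map_zero]

/-- Every socle element of `B' / soc B'` has a finite orbit under the lambda maps. -/
theorem finite_range_lam_quotient_socle (hn : 1 < AddMonoid.exponent A) (ht : 0 < orderOf D.t)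
    {s : (LeftBrace.socle D.B').Quotient} (hs : s ∈ (LeftBrace.socle _).toSubgroup) :
    (Set.range fun b => LeftBrace.lam b s).Finite := by
  have hT : Finite D.T := (orderOf_pos_iff.1 ht).finite_zpowers
  obtain ⟨x, rfl⟩ := (LeftBrace.socle D.B').toQuot_surjective s
  -- The class of `x` lies in the socle of the quotient when `λ_x` moves every `y` only within its
  -- coset.
  have hx : ∀ y : D.B', -LeftBrace.lam x y + y ∈ (LeftBrace.socle D.B').toSubgroup := fun y => by
    have h := LeftBrace.mem_socle_iff.1 hs ((LeftBrace.socle D.B').toQuot y)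
    rw [← LeftBrace.Ideal.toQuot_lam, LeftBrace.Ideal.toQuot_eq_iff,
      ← LeftBrace.Ideal.neg_add_mem_iff] at h
    exact h
  simp only [D.mem_socle_iff hn, neg_add_snd, neg_add_fst, lam_eq] at hx
  have hu : x.snd.snd = 1 := by
    refine Subtype.ext (LinearEquiv.ext fun c => ?_)
    have h := congrArg SemiBrace.fst (hx ⟨0, ⟨c, 1⟩⟩).1
    dsimp only at h
    rw [map_zero, pairing_zero, pairing_zero, sub_zero, sub_zero, add_zero,
      neg_add_eq_zero] at h
    exact h
  have hf : ∀ k, D.pairing x.fst k = 0 := by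
    intro k
    obtain ⟨h, rfl⟩ := (D.α' x.snd).surjective k
    -- Write `k = α' h`, with `α'` the action of `x.snd`. Vanishing of the `A`-coordinate gives
    -- `b'(f, k) + b'(k, k) - b'(k, h) = 0` with `f = x.fst`. Since `h - k` lies in the radical,
    -- pairing it with `k` cancels the last two terms.
    obtain ⟨h1, h2⟩ := hx ⟨h, ⟨0, 1⟩⟩
    have h1 := congrArg SemiBrace.fst h1
    have h2 := h2 (D.α' x.snd h)
    dsimp only at h1 h2
    rw [pairing_add, pairing_neg, neg_add_eq_zero, D.pairing_symm h] at h2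
    rwa [map_zero, zero_sub, neg_neg, add_zero, h2, add_sub_cancel_right] at h1
  -- As `x.fst` and its images under `α'` lie in the radical, they vanish modulo the socle. What is
  -- left of `λ_b x` is `(0, (v a, 1))` with `a = x.snd.fst`, and this depends on `b` only through
  -- its `T`-coordinate `v`.
  refine (Set.finite_range fun v : D.T =>
    (LeftBrace.socle D.B').toQuot ⟨0, ⟨v.1 x.snd.fst, 1⟩⟩).subset ?_
  rintro _ ⟨b, rfl⟩
  obtain ⟨b, rfl⟩ := (LeftBrace.socle D.B').toQuot_surjective b
  refine ⟨b.snd.snd, Eq.symm ?_⟩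
  dsimp only
  rw [← LeftBrace.Ideal.toQuot_lam, LeftBrace.Ideal.toQuot_eq_iff,
    ← LeftBrace.Ideal.neg_add_mem_iff]
  refine (D.mem_socle_iff hn _).2 ?_
  rw [neg_add_snd, neg_add_fst, lam_eq]
  have hα := D.pairing_α'_eq_zero hf b.snd
  refine ⟨SemiBrace.ext ?_ ?_, fun h => ?_⟩
  · dsimp only
    rw [hα, hα, D.pairing_symm, hα, sub_zero, sub_zero, add_zero,
      neg_add_cancel]
  · dsimp only
    rw [hu, inv_one, one_mul]
  · dsimp only
    rw [add_zero, pairing_neg, hα, neg_zero]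

/-- An isomorphism carries socles to socles and lambda orbits to lambda orbits, so `(f, 0)` has a
finite orbit. If `f ≠ 0`, this makes `A` and hence `B'` finite, and then the counting argument
applies. -/
theorem eq_of_mem_socle (hn : 1 < AddMonoid.exponent A) (ht : 0 < orderOf D.t)
    (e : D.B' ≃+* (LeftBrace.socle D.B').Quotient) {f : D.H'} (hf : ∀ h, D.pairing f h = 0) :
    f = 0 := by
  have hs : (⟨f, ⟨0, 1⟩⟩ : D.B') ∈ (LeftBrace.socle D.B').toSubgroup :=
    (D.mem_socle_iff hn _).2 ⟨rfl, hf⟩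
  by_contra hne
  have hfin : Finite A := by
    refine D.finite_of_finite_range_translation hne ?_
    have h1 := D.finite_range_lam_quotient_socle hn ht (LeftBrace.map_mem_socle e hs)
    -- Pulled back along `e`, the finite orbit is that of `(f, 0)`. The elements `(0, (a, 1))` alone
    -- produce every translate of `f` as a first coordinate.
    refine Set.Finite.subset (h1.image fun y => (e.symm y).fst) ?_
    rintro _ ⟨a, rfl⟩
    refine ⟨_, ⟨e ⟨0, ⟨a, 1⟩⟩, rfl⟩, ?_⟩
    dsimp only
    rw [← LeftBrace.map_lam, RingEquiv.symm_apply_apply, lam_eq]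
  have := D.finite_B' hn ht
  exact hne (congrArg AsymData.Product.fst (LeftBrace.eq_one_of_mem_socle e hs))

/-! ### Additive generation of `B'` by `X'` -/

/-- An additive subgroup of `B'` that contains `A` determines a subgroup of `H' × T`. -/
def subgroupProd (N : AddSubgroup D.B') (hN : ∀ c : A, (⟨0, ⟨c, 1⟩⟩ : D.B') ∈ N) :
    AddSubgroup (D.H' × Additive D.T) where
  carrier := {w | ∀ c : A, (⟨w.1, ⟨c, w.2.toMul⟩⟩ : D.B') ∈ N}
  zero_mem' := hN
  add_mem' {v w} hv hw c := by
    -- Every `A`-coordinate is available, so the value of `b'` that arises in the sum can be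
    -- subtracted in advance.
    have h := N.add_mem (hv (c - D.pairing v.1 w.1)) (hw 0)
    convert h using 1
    refine AsymData.Product.ext rfl (SemiBrace.ext ?_ ?_)
    · change c = c - D.pairing v.1 w.1 + 0 + D.pairing v.1 w.1
      abel
    · exact (mul_one _).symm
  neg_mem' {w} hw c := by
    -- With this `A`-coordinate the negative has `A`-coordinate `0`, because negation in `B'` adds
    -- `b'(w, w)`. The second summand then sets it to `c`.
    have h := N.add_mem (N.neg_mem (hw (D.pairing w.1 w.1))) (hN c)
    convert h using 1
    refine AsymData.Product.ext (add_zero _).symm ?_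
    rw [neg_add_snd, pairing_zero]
    refine SemiBrace.ext ?_ (mul_one _).symm
    change c = -D.pairing w.1 w.1 + D.pairing w.1 w.1 + c - 0
    abel

/-- The set `X'` generates the additive group of `B'`. -/
theorem closure_X' (ht : Nat.Coprime (orderOf D.t) (AddMonoid.exponent A)) :
    AddSubgroup.closure D.X' = ⊤ := by
  set N := AddSubgroup.closure D.X'
  let τ : D.T := ⟨D.t, Subgroup.mem_zpowers D.t⟩
  have hX : ∀ a c : A, (⟨Finsupp.single a 1, ⟨c, τ⟩⟩ : D.B') ∈ N := fun a c =>
    AddSubgroup.subset_closure ((D.mem_X'_iff _).2 ⟨⟨a, rfl⟩, rfl⟩)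
  have hA : ∀ c : A, (⟨0, ⟨c, 1⟩⟩ : D.B') ∈ N := fun c => by
    have h := N.add_mem (N.neg_mem (hX 0 0)) (hX 0 c)
    convert h using 1
    refine AsymData.Product.ext (neg_add_cancel _).symm ?_
    rw [neg_add_snd]
    refine SemiBrace.ext ?_ (inv_mul_cancel _).symm
    dsimp only
    abel
  let K := D.subgroupProd N hA
  have hK : ∀ a : A, (Finsupp.single a 1, Additive.ofMul τ) ∈ K := fun a => hX a
  have hτ : ((0 : D.H'), Additive.ofMul τ) ∈ K := by
    have hord : orderOf τ = orderOf D.t := Subgroup.orderOf_mk _ _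
    -- Multiplying `(e_0, t)` by `n` kills the `H'`-part and leaves `t^n`. By coprimality some power
    -- `m` of `t^n` is `t`.
    obtain ⟨m, hm⟩ := exists_pow_eq_self_of_coprime (x := τ) (hord ▸ ht.symm)
    have h := K.nsmul_mem (K.nsmul_mem (hK 0) (AddMonoid.exponent A)) m
    convert h using 1
    refine Prod.ext ?_ ?_
    · change (0 : D.H') = m • AddMonoid.exponent A • Finsupp.single (0 : A) 1
      rw [Finsupp.smul_single, nsmul_one, ZMod.natCast_self, Finsupp.single_zero, smul_zero]
    · exact congrArg Additive.ofMul hm.symm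
  have hT : ∀ u : D.T, ((0 : D.H'), Additive.ofMul u) ∈ K := by
    rintro ⟨_, z, rfl⟩
    have h := K.zsmul_mem hτ z
    convert h using 1
    exact Prod.ext (smul_zero z).symm (congrArg Additive.ofMul (Subtype.ext rfl))
  have hH : ∀ f : D.H', (f, (0 : Additive D.T)) ∈ K := by
    intro f
    induction f using Finsupp.induction_linear with
    | zero => exact K.zero_mem
    | add f g hf hg => simpa using K.add_mem hf hg
    | single a m =>
      -- Residues are lifted to integers, so that the single-point function is an integer multiple
      -- of `(e_a, t) - (0, t)`.
      obtain ⟨m, rfl⟩ := ZMod.intCast_surjective m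
      have h := K.zsmul_mem (K.sub_mem (hK a) hτ) m
      simpa using h
  refine (AddSubgroup.eq_top_iff' _).2 fun q => ?_
  have h := K.add_mem (hH q.fst) (hT q.snd.snd) q.snd.fst
  simpa using h

end JFamily

/-! ### Assembly of the three assertions -/

theorem proposition4p4 {A : Type*} [AddCommGroup A] (D : JFamily A)
    (hn : 1 < AddMonoid.exponent A)
    (ht : Nat.Coprime (orderOf D.t) (AddMonoid.exponent A)) :
    Nonempty ((LeftBrace.socle D.B').Quotient ≃+* D.solution.PermGroup) ∧
    ((LeftBrace.socle D.B').carrier =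
      {x : D.B' | ∃ f : D.H', x = ⟨f, ⟨0, 1⟩⟩ ∧ ∀ h : D.H', D.b' f h = ⟨0, 1⟩}) ∧
    (Nonempty (D.B' ≃+* D.solution.PermGroup) ↔
      ∀ f : D.H', (∀ h : D.H', D.b' f h = ⟨0, 1⟩) → f = 0) := by
  have hpos := D.orderOf_t_pos hn ht
  simp only [D.b'_eq_zero_iff]
  obtain ⟨e⟩ : Nonempty ((LeftBrace.socle D.B').Quotient ≃+* D.solution.PermGroup) :=
    LeftBrace.nonempty_quotient_socle_equiv _ _ (D.closure_X' ht)
  refine ⟨⟨e⟩, ?_, ?_, ?_⟩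
  · ext x
    refine (D.mem_socle_iff hn x).trans ⟨fun h => ⟨x.fst, ?_, h.2⟩, ?_⟩
    · exact AsymData.Product.ext rfl h.1
    · rintro ⟨f, rfl, hf⟩
      exact ⟨rfl, hf⟩
  · rintro ⟨e'⟩ f hf
    -- Composing with the first assertion replaces the permutation group by `B' / soc B'`.
    exact D.eq_of_mem_socle hn hpos (e'.trans e.symm) hf
  · intro h
    obtain ⟨e'⟩ := LeftBrace.nonempty_equiv_quotient_socle (B := D.B') fun a ha => by
      rw [D.mem_socle_iff hn] at ha
      exact AsymData.Product.ext (h _ ha.2) ha.1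
    exact ⟨e'.trans e⟩
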